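/- A lattice is a subgroup of finite index of $\mathbb{Z}^2$. A covering is a finite set $\mathcal{C}$ of lattices with $\mathbb{Z}^2=\bigcup_{L\in\mathcal{C}}L$; it is irredundant if no proper subset of $\mathcal{C}$ is a covering. Let $G$ be the additive arithmetic function given by $G\bigl(\prod_{i=1}^{t}p_i^{e_i}\bigr)=\sum_{i=1}^{t}\bigl(e_i(p_i-1)+1\bigr)$ for distinct primes $p_i$ and exponents $e_i\ge 1$ (so $G(1)=0$). Theorem. Let $\mathcal{C}$ be an irredundant covering and let $N=\operatorname{lcm}\{[\mathbb{Z}^2:L] : L\in\mathcal{C}\}$. (1) For every divisor $D$ of $N$ with $D\neq N$, $$\bigl|\{L\in\mathcal{C} : [\mathbb{Z}^2:L]\nmid D\}\bigr|\ \ge\ 1+G(N)-G(D).$$ (2) In particular, if $\mathcal{C}$ is not the trivial covering $\{\mathbb{Z}^2\}$, then $N>1$ and $|\mathcal{C}|\ge 1+G(N)$. (3) If $N=\prod_{i=1}^{t}p_i^{e_i}$ is the prime factorization of $N$, then $|\mathcal{C}|\ge t+1+\sum_{i=1}^{t}e_i(p_i-1)$. -/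

import Mathlib

/-- A lattice is a subgroup of finite index of `ℤ²`; a finite collection `C` of lattices is a
covering if `ℤ²` is the union of the members of `C`. -/
structure IsLatticeCovering (C : Finset (AddSubgroup (ℤ × ℤ))) : Prop where
  finiteIndex : ∀ L ∈ C, L.FiniteIndex
  covers : (⋃ L ∈ C, (L : Set (ℤ × ℤ))) = Set.univ

/-- A covering is irredundant if no proper subset of it is a covering. -/
structure IsIrredundantCovering (C : Finset (AddSubgroup (ℤ × ℤ))) : Prop where
  isCovering : IsLatticeCovering C
  irredundant : ∀ C' : Finset (AddSubgroup (ℤ × ℤ)), C' ⊂ C → ¬ IsLatticeCovering C'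

/-- The index lcm of a finite collection of lattices. -/
noncomputable def indexLcm (C : Finset (AddSubgroup (ℤ × ℤ))) : ℕ :=
  C.lcm fun L => L.index

/-- The additive arithmetic function with `G (p ^ e) = e * (p - 1) + 1` for `p` prime, `1 ≤ e`. -/
def simpsonG (n : ℕ) : ℕ :=
  ∑ p ∈ n.primeFactors, (n.factorization p * (p - 1) + 1)

/-! Irredundance puts a primitive vector `c` in each member `L`, so `L` is the congruence `n ∣
vecDet c x` with `n` its index (`mem_iff_index_dvd_vecDet`).

`simpsonG n` counts slots: each prime `p` dividing `n` has `p` slots at level 1 and `p - 1` at every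
later level up to its exponent. Suppose a proper divisor `M` of the lcm `N` minimises, among all
divisors, the number of lattices of index not dividing `M` plus `simpsonG M`. Minimality against
larger divisors is Hall's condition, so these lattices receive distinct slots outside `slots M`.
Some primitive vector avoids all the other lattices; changing it by multiples of `M`, one `p`-adic
digit at a time, makes it avoid each remaining lattice at the level of its slot (`exists_avoiding`).
This works because `p` lines miss one of the `p + 1` directions modulo `p`, and `p - 1` lattices
miss one of `p` values of a later digit. The resulting vector is uncovered, a contradiction
(`not_minimal`). Hence `N` is the only minimiser, which is the bound `simpsonG_lt`. -/

/-! ### Lattices and primitive vectors -/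

/-- The determinant of two integer vectors. -/
def vecDet (c w : ℤ × ℤ) : ℤ := c.1 * w.2 - c.2 * w.1

/-- The additive homomorphism `vecDet c`. -/
def vecDetHom (c : ℤ × ℤ) : ℤ × ℤ →+ ℤ where
  toFun := vecDet c
  map_zero' := by simp [vecDet]
  map_add' x y := by simp only [vecDet, Prod.fst_add, Prod.snd_add]; ring

/-- A subgroup of `ℤ²` containing a primitive vector `c` is cut out by a congruence on
`vecDet c`, modulo its index. -/
theorem mem_iff_index_dvd_vecDet {L : AddSubgroup (ℤ × ℤ)} {c : ℤ × ℤ}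
    (hc : IsCoprime c.1 c.2) (hL : c ∈ L) (x : ℤ × ℤ) :
    x ∈ L ↔ (L.index : ℤ) ∣ vecDet c x := by
  obtain ⟨a, b, hab⟩ := hc
  -- Bézout gives `vecDet c r = 1`: `c` and `r` form a basis, and since `c ∈ L` only the
  -- `r`-coordinate `vecDet c x` decides membership.
  let r : ℤ × ℤ := (-b, a)
  have hdecomp (x : ℤ × ℤ) : x = (a * x.1 + b * x.2) • c + vecDet c x • r := by
    ext
    · simp only [r, vecDet, Prod.fst_add, Prod.smul_fst, smul_eq_mul]
      linear_combination -x.1 * hab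
    · simp only [r, vecDet, Prod.snd_add, Prod.smul_snd, smul_eq_mul]
      linear_combination -x.2 * hab
  have hmem (x : ℤ × ℤ) : x ∈ L ↔ vecDet c x • r ∈ L := by
    conv_lhs => rw [hdecomp x]
    exact L.add_mem_cancel_left (L.zsmul_mem hL _)
  obtain ⟨n, hn⟩ := Int.subgroup_cyclic (L.comap (zmultiplesHom (ℤ × ℤ) r))
  have hn' : L.comap (zmultiplesHom (ℤ × ℤ) r) = AddSubgroup.zmultiples n := by
    rw [hn, AddSubgroup.zmultiples_eq_closure]
  have hLn : L = (AddSubgroup.zmultiples n).comap (vecDetHom c) := by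
    ext x
    rw [hmem, ← hn']
    simp [AddSubgroup.mem_comap, vecDetHom]
  have hsurj : Function.Surjective (vecDetHom c) := by
    intro m
    refine ⟨m • r, ?_⟩
    simp only [vecDetHom, vecDet, r, AddMonoidHom.coe_mk, ZeroHom.coe_mk, Prod.smul_fst,
      Prod.smul_snd, smul_eq_mul]
    linear_combination m * hab
  have hidx : L.index = n.natAbs := by
    conv_lhs => rw [hLn]
    rw [AddSubgroup.index_comap_of_surjective _ hsurj, Int.index_zmultiples]
  rw [hidx, Int.natAbs_dvd, ← Int.mem_zmultiples_iff]
  conv_lhs => rw [hLn]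
  rfl

/-- Every integer vector is a multiple of a primitive one. -/
theorem exists_eq_smul_isCoprime (x : ℤ × ℤ) :
    ∃ (g : ℤ) (y : ℤ × ℤ), IsCoprime y.1 y.2 ∧ x = g • y := by
  by_cases h : x = 0
  · exact ⟨0, (1, 0), isCoprime_one_left, by simp [h]⟩
  · have hg : 0 < Int.gcd x.1 x.2 := by
      rw [Int.gcd_pos_iff]
      by_contra! hx
      exact h (Prod.ext hx.1 hx.2)
    obtain ⟨a, b, hab, ha, hb⟩ := Int.exists_gcd_one hg
    refine ⟨Int.gcd x.1 x.2, (a, b), Int.isCoprime_iff_gcd_eq_one.2 hab, ?_⟩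
    ext
    · simpa [mul_comm] using ha
    · simpa [mul_comm] using hb

/-- Otherwise every primitive vector lies in another member, which then contains all its multiples,
and `L` is redundant. -/
theorem IsIrredundantCovering.exists_isCoprime_mem {C : Finset (AddSubgroup (ℤ × ℤ))}
    (hC : IsIrredundantCovering C) {L : AddSubgroup (ℤ × ℤ)} (hL : L ∈ C) :
    ∃ c ∈ L, IsCoprime c.1 c.2 := by
  classical
  by_contra! h
  refine hC.irredundant _ (Finset.erase_ssubset hL)
    ⟨fun K hK => hC.isCovering.finiteIndex K (Finset.mem_of_mem_erase hK), ?_⟩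
  refine Set.eq_univ_of_forall fun x => ?_
  obtain ⟨g, y, hy, rfl⟩ := exists_eq_smul_isCoprime x
  have hyC : y ∈ ⋃ K ∈ C, (K : Set (ℤ × ℤ)) := hC.isCovering.covers ▸ Set.mem_univ y
  simp only [Set.mem_iUnion, SetLike.mem_coe, exists_prop] at hyC ⊢
  obtain ⟨K, hK, hyK⟩ := hyC
  refine ⟨K, Finset.mem_erase.2 ⟨?_, hK⟩, K.zsmul_mem hyK g⟩
  rintro rfl
  exact h y hyK hy

/-- A proper subcollection of an irredundant covering is avoided by some primitive vector. -/
theorem IsIrredundantCovering.exists_isCoprime_notMem {C C' : Finset (AddSubgroup (ℤ × ℤ))}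
    (hC : IsIrredundantCovering C) (hC' : C' ⊂ C) :
    ∃ v : ℤ × ℤ, IsCoprime v.1 v.2 ∧ ∀ L ∈ C', v ∉ L := by
  by_contra! h
  refine hC.irredundant C' hC' ⟨fun L hL => hC.isCovering.finiteIndex L (hC'.1 hL), ?_⟩
  refine Set.eq_univ_of_forall fun x => ?_
  obtain ⟨g, y, hy, rfl⟩ := exists_eq_smul_isCoprime x
  obtain ⟨L, hL, hyL⟩ := h y hy
  simp only [Set.mem_iUnion, SetLike.mem_coe, exists_prop]
  exact ⟨L, hL, L.zsmul_mem hyL g⟩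

/-! ### Slots -/

/-- The value of `simpsonG` at `p ^ j`. -/
def primeSlots (p j : ℕ) : ℕ := if j = 0 then 0 else j * (p - 1) + 1

theorem primeSlots_mono (p : ℕ) : Monotone (primeSlots p) := by
  intro a b hab
  unfold primeSlots
  split_ifs with ha hb
  · exact le_rfl
  · exact Nat.zero_le _
  · omega
  · gcongr

/-- A set of `simpsonG n` elements, monotone in `n`. -/
def slots (n : ℕ) : Finset (Σ _ : ℕ, ℕ) :=
  n.primeFactors.sigma fun p => Finset.range (primeSlots p (n.factorization p))

theorem card_slots (n : ℕ) : (slots n).card = simpsonG n := by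
  rw [slots, Finset.card_sigma, simpsonG]
  refine Finset.sum_congr rfl fun p hp => ?_
  have : n.factorization p ≠ 0 := Finsupp.mem_support_iff.1 hp
  simp [primeSlots, this]

theorem mem_slots {n p k : ℕ} : (⟨p, k⟩ : Σ _ : ℕ, ℕ) ∈ slots n ↔
    k < primeSlots p (n.factorization p) := by
  simp only [slots, Finset.mem_sigma, Finset.mem_range, and_iff_right_iff_imp]
  intro h
  by_contra hp
  have : n.factorization p = 0 := Finsupp.notMem_support_iff.1 hp
  simp [primeSlots, this] at h

theorem slots_subset {m n : ℕ} (hn : n ≠ 0) (h : m ∣ n) : slots m ⊆ slots n := by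
  rintro ⟨p, k⟩ hk
  rw [mem_slots] at hk ⊢
  exact hk.trans_le (primeSlots_mono p ((Nat.factorization_le_iff_dvd
    (ne_zero_of_dvd_ne_zero hn h) hn).2 h p))

/-- Exponents in an lcm are maxima, and the slots at one prime are nested initial segments. -/
theorem slots_lcm {m n : ℕ} (hm : m ≠ 0) (hn : n ≠ 0) :
    slots (m.lcm n) = slots m ∪ slots n := by
  ext ⟨p, k⟩
  rw [Finset.mem_union, mem_slots, mem_slots, mem_slots, Nat.factorization_lcm hm hn,
    Finsupp.sup_apply, (primeSlots_mono p).map_sup, lt_sup_iff]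

theorem slots_finset_lcm {ι : Type*} [DecidableEq ι] (s : Finset ι) (f : ι → ℕ)
    (hf : ∀ i ∈ s, f i ≠ 0) : slots (s.lcm f) = s.biUnion fun i => slots (f i) := by
  induction s using Finset.induction_on with
  | empty => simp [slots]
  | insert a s ha ih =>
    have hs : s.lcm f ≠ 0 := by
      rw [Ne, Finset.lcm_eq_zero_iff]
      rintro ⟨i, hi, h0⟩
      exact hf i (Finset.mem_insert_of_mem hi) h0
    rw [Finset.lcm_insert, Finset.biUnion_insert,
      ← ih fun i hi => hf i (Finset.mem_insert_of_mem hi)]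
    exact slots_lcm (hf a (Finset.mem_insert_self a s)) hs

/-- Every slot of `p ^ e` belongs to some level `j ≤ e`. -/
theorem exists_level {p e k : ℕ} (h : k < primeSlots p e) :
    ∃ j, 1 ≤ j ∧ j ≤ e ∧ primeSlots p (j - 1) ≤ k ∧ k < primeSlots p j := by
  classical
  have hex : ∃ j, k < primeSlots p j := ⟨e, h⟩
  have hpos : 1 ≤ Nat.find hex := by
    rw [Nat.one_le_iff_ne_zero]
    intro h0
    have hspec := Nat.find_spec hex
    rw [h0] at hspec
    simp [primeSlots] at hspec
  exact ⟨Nat.find hex, hpos, Nat.find_min' hex h,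
    not_lt.1 (Nat.find_min hex (by omega)), Nat.find_spec hex⟩

/-! ### Choosing digits -/

/-- Pigeonhole: each constraint spoils at most one candidate. -/
theorem exists_forall_not_of_card_lt {ι κ : Type*} (s : Finset ι) (t : Finset κ)
    (bad : ι → κ → Prop) (hcard : s.card < t.card)
    (hbad : ∀ i ∈ s, ∀ a ∈ t, ∀ b ∈ t, bad i a → bad i b → a = b) :
    ∃ a ∈ t, ∀ i ∈ s, ¬ bad i a := by
  by_contra! h
  obtain ⟨a₀, ha₀⟩ := Finset.card_pos.1 (Nat.zero_lt_of_lt hcard)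
  obtain ⟨i₀, -⟩ := h a₀ ha₀
  have : Nonempty ι := ⟨i₀⟩
  choose! f hfs hf using h
  obtain ⟨a, ha, b, hb, hne, hab⟩ :=
    Finset.exists_ne_map_eq_of_card_lt_of_maps_to (f := f) hcard
      fun a ha => hfs a ha
  exact hne (hbad _ (hfs a ha) a ha b hb (hf a ha) (hab ▸ hf b hb))

/-- Modulo `p`, both vectors lie on the line spanned by `c`; Bézout coefficients of `c` replace
division. -/
theorem dvd_vecDet_of_dvd {p : ℕ} {c w u : ℤ × ℤ} (hc : IsCoprime c.1 c.2)
    (hw : (p : ℤ) ∣ vecDet c w) (hu : (p : ℤ) ∣ vecDet c u) : (p : ℤ) ∣ vecDet w u := by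
  have h1 : (p : ℤ) ∣ c.1 * vecDet w u := by
    have : c.1 * vecDet w u = w.1 * vecDet c u - u.1 * vecDet c w := by
      simp only [vecDet]; ring
    exact this ▸ dvd_sub (hu.mul_left _) (hw.mul_left _)
  have h2 : (p : ℤ) ∣ c.2 * vecDet w u := by
    have : c.2 * vecDet w u = w.2 * vecDet c u - u.2 * vecDet c w := by
      simp only [vecDet]; ring
    exact this ▸ dvd_sub (hu.mul_left _) (hw.mul_left _)
  obtain ⟨a, b, hab⟩ := hc
  have : vecDet w u = a * (c.1 * vecDet w u) + b * (c.2 * vecDet w u) := by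
    linear_combination -vecDet w u * hab
  exact this ▸ dvd_add (h1.mul_left _) (h2.mul_left _)

theorem natCast_eq_of_dvd_sub {p a b : ℕ} (ha : a < p) (hb : b < p)
    (h : (p : ℤ) ∣ (a : ℤ) - b) : a = b :=
  (Nat.ModEq.eq_of_lt_of_lt ((Nat.modEq_iff_dvd).2 h) hb ha).symm

/-- A choice of the first digit: `p` lines do not cover the plane modulo `p`. -/
theorem exists_first_digit {ι : Type*} {p : ℕ} (hp : p.Prime) (c : ι → ℤ × ℤ)
    (hc : ∀ i, IsCoprime (c i).1 (c i).2) (s : Finset ι) (hs : s.card ≤ p) :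
    ∃ w : ℤ × ℤ, ¬ ((p : ℤ) ∣ w.1 ∧ (p : ℤ) ∣ w.2) ∧ ∀ i ∈ s, ¬ (p : ℤ) ∣ vecDet (c i) w := by
  -- Representatives of the `p + 1` points of the projective line modulo `p`; each lattice is bad
  -- for at most one.
  let g : Option (Fin p) → ℤ × ℤ := fun o => o.elim (0, 1) fun t => (1, (t : ℕ))
  have hp1 : ¬ (p : ℤ) ∣ 1 := fun h =>
    (Nat.prime_iff_prime_int.1 hp).not_isUnit (isUnit_of_dvd_one h)
  obtain ⟨a, -, ha⟩ := exists_forall_not_of_card_lt s (Finset.univ : Finset (Option (Fin p)))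
    (fun i o => (p : ℤ) ∣ vecDet (c i) (g o)) (by simp; omega) (by
      intro i _ a _ b _ hA hB
      have h := dvd_vecDet_of_dvd (hc i) hA hB
      rcases a with _ | a <;> rcases b with _ | b
      · rfl
      · exact absurd (by simpa [g, vecDet] using h) hp1
      · exact absurd (by simpa [g, vecDet] using h) hp1
      · have h' : (p : ℤ) ∣ ((b : ℕ) : ℤ) - (a : ℕ) := by simpa [g, vecDet] using h
        rw [Fin.ext (natCast_eq_of_dvd_sub b.2 a.2 h')])
  refine ⟨g a, ?_, ha⟩
  rcases a with _ | a
  · exact fun h => hp1 h.2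
  · exact fun h => hp1 h.1

theorem exists_not_dvd_vecDet {p : ℕ} {w : ℤ × ℤ} (hw : ¬ ((p : ℤ) ∣ w.1 ∧ (p : ℤ) ∣ w.2)) :
    ∃ u : ℤ × ℤ, ¬ (p : ℤ) ∣ vecDet w u := by
  by_cases h : (p : ℤ) ∣ w.1
  · exact ⟨(1, 0), by simpa [vecDet] using fun h2 => hw ⟨h, h2⟩⟩
  · exact ⟨(0, 1), by simpa [vecDet] using h⟩

/-- A choice of a later digit. -/
theorem exists_next_digit {ι : Type*} {p : ℕ} (hp : p.Prime) (c : ι → ℤ × ℤ)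
    (hc : ∀ i, IsCoprime (c i).1 (c i).2) (s : Finset ι) (hs : s.card < p) {w : ℤ × ℤ}
    (hw : ¬ ((p : ℤ) ∣ w.1 ∧ (p : ℤ) ∣ w.2)) (j : ℕ) :
    ∃ u : ℤ × ℤ, ∀ i ∈ s, ¬ (p : ℤ) ^ (j + 1) ∣ vecDet (c i) (w + (p : ℤ) ^ j • u) := by
  obtain ⟨u, hu⟩ := exists_not_dvd_vecDet hw
  have hp0 : (p : ℤ) ≠ 0 := by exact_mod_cast hp.ne_zero
  have hpp : Prime (p : ℤ) := Nat.prime_iff_prime_int.1 hp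
  have hexp (i : ι) (t : ℕ) : vecDet (c i) (w + (p : ℤ) ^ j • ((t : ℤ) • u)) =
      vecDet (c i) w + (p : ℤ) ^ j * (t * vecDet (c i) u) := by
    simp only [vecDet, Prod.fst_add, Prod.snd_add, Prod.smul_fst, Prod.smul_snd, smul_eq_mul]
    ring
  obtain ⟨t, -, ht⟩ := exists_forall_not_of_card_lt s (Finset.range p)
    (fun i t => (p : ℤ) ^ (j + 1) ∣ vecDet (c i) (w + (p : ℤ) ^ j • ((t : ℤ) • u)))
    (by simpa using hs) (by
      intro i _ a ha b hb hA hB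
      rw [hexp] at hA hB
      have hsub : (p : ℤ) ^ j * p ∣ (p : ℤ) ^ j * ((a - b) * vecDet (c i) u) := by
        have heq : (p : ℤ) ^ j * ((a - b) * vecDet (c i) u) =
            vecDet (c i) w + (p : ℤ) ^ j * (a * vecDet (c i) u) -
              (vecDet (c i) w + (p : ℤ) ^ j * (b * vecDet (c i) u)) := by ring
        rw [heq, ← pow_succ]
        exact dvd_sub hA hB
      rcases hpp.dvd_or_dvd ((mul_dvd_mul_iff_left (pow_ne_zero j hp0)).1 hsub) with h | h
      · exact natCast_eq_of_dvd_sub (Finset.mem_range.1 ha) (Finset.mem_range.1 hb) h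
      -- Here the digit has no influence modulo `p ^ (j + 1)`, but then `p` divides `vecDet (c i) w`
      -- as well, against the choice of `u`.
      · refine absurd (dvd_vecDet_of_dvd (hc i) ?_ h) hu
        have h1 : (p : ℤ) ∣ vecDet (c i) w + (p : ℤ) ^ j * (a * vecDet (c i) u) :=
          (dvd_pow_self _ j.succ_ne_zero).trans hA
        exact (dvd_add_left ((h.mul_left _).mul_left _)).1 h1)
  exact ⟨(t : ℤ) • u, ht⟩

theorem vecDet_add_smul (c w u : ℤ × ℤ) (m : ℤ) :
    vecDet c (w + m • u) = vecDet c w + m * vecDet c u := by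
  simp only [vecDet, Prod.fst_add, Prod.snd_add, Prod.smul_fst, Prod.smul_snd, smul_eq_mul]
  ring

/-- One step of the digit by digit construction. -/
theorem exists_digit {ι : Type*} {p : ℕ} (hp : p.Prime) (c : ι → ℤ × ℤ)
    (hc : ∀ i, IsCoprime (c i).1 (c i).2) (j : ℕ) (s : Finset ι)
    (hs : s.card ≤ primeSlots p (j + 1) - primeSlots p j) (w : ℤ × ℤ)
    (hw : j ≠ 0 → ¬ ((p : ℤ) ∣ w.1 ∧ (p : ℤ) ∣ w.2)) :
    ∃ u : ℤ × ℤ, (¬ ((p : ℤ) ∣ (w + (p : ℤ) ^ j • u).1 ∧ (p : ℤ) ∣ (w + (p : ℤ) ^ j • u).2)) ∧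
      ∀ i ∈ s, ¬ (p : ℤ) ^ (j + 1) ∣ vecDet (c i) (w + (p : ℤ) ^ j • u) := by
  have hp1 := hp.one_lt
  rcases Nat.eq_zero_or_pos j with rfl | hj
  -- Since `p ^ 0 = 1`, the first digit may replace `w` altogether.
  · obtain ⟨w', h1, h2⟩ := exists_first_digit hp c hc s (by simp [primeSlots] at hs; omega)
    exact ⟨w' - w, by simpa using h1, by simpa using h2⟩
  · have hs' : s.card < p := by
      simp only [primeSlots, hj.ne', Nat.succ_ne_zero, if_false, Nat.add_mul, one_mul] at hs
      omega
    obtain ⟨u, hu⟩ := exists_next_digit hp c hc s hs' (hw hj.ne') j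
    refine ⟨u, fun h => hw hj.ne' ?_, hu⟩
    have hpj : (p : ℤ) ∣ (p : ℤ) ^ j := dvd_pow_self _ hj.ne'
    simp only [Prod.fst_add, Prod.snd_add, Prod.smul_fst, Prod.smul_snd, smul_eq_mul] at h
    exact ⟨(dvd_add_left (hpj.mul_right _)).1 h.1, (dvd_add_left (hpj.mul_right _)).1 h.2⟩

/-- A vector can be modified modulo powers of `p` beyond `p ^ a` so as to avoid, at each later
level, as many lattices as there are slots at this level. -/
theorem exists_digits {ι : Type*} {p : ℕ} (hp : p.Prime) (c : ι → ℤ × ℤ)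
    (hc : ∀ i, IsCoprime (c i).1 (c i).2) (s : ℕ → Finset ι)
    (hs : ∀ j, (s (j + 1)).card ≤ primeSlots p (j + 1) - primeSlots p j) (v : ℤ × ℤ)
    (hv : ¬ ((p : ℤ) ∣ v.1 ∧ (p : ℤ) ∣ v.2)) (a m : ℕ) :
    ∃ u : ℤ × ℤ,
      (¬ ((p : ℤ) ∣ (v + (p : ℤ) ^ a • u).1 ∧ (p : ℤ) ∣ (v + (p : ℤ) ^ a • u).2)) ∧
      ∀ j, a < j → j ≤ a + m → ∀ i ∈ s j, ¬ (p : ℤ) ^ j ∣ vecDet (c i) (v + (p : ℤ) ^ a • u) := by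
  induction m with
  | zero => exact ⟨0, by simpa using hv, fun j h1 h2 => by omega⟩
  | succ m ih =>
    obtain ⟨u, hu, h⟩ := ih
    obtain ⟨u', hu', h'⟩ := exists_digit hp c hc (a + m) (s (a + m + 1)) (hs _) _ fun _ => hu
    have hrw : v + (p : ℤ) ^ a • (u + (p : ℤ) ^ m • u') =
        v + (p : ℤ) ^ a • u + (p : ℤ) ^ (a + m) • u' := by
      rw [smul_add, smul_smul, ← pow_add, add_assoc]
    refine ⟨u + (p : ℤ) ^ m • u', hrw ▸ hu', fun j h1 h2 i hi => ?_⟩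
    rw [hrw]
    rcases Nat.lt_or_ge (a + m) j with hj | hj
    · obtain rfl : j = a + m + 1 := by omega
      exact h' i hi
    · rw [vecDet_add_smul]
      exact fun hd => h j h1 hj i hi
        ((dvd_add_left ((pow_dvd_pow _ hj).mul_right _)).1 hd)

/-! ### Combining the primes -/

/-- Chinese remainder theorem, used on each coordinate to glue the vectors built for the separate
primes. -/
theorem exists_forall_dvd_sub (s : Finset ℕ) (hs : ∀ p ∈ s, p.Prime) (e : ℕ → ℕ) (f : ℕ → ℤ) :
    ∃ x : ℤ, ∀ p ∈ s, (p : ℤ) ^ e p ∣ x - f p := by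
  obtain ⟨x, hx⟩ := Ideal.exists_forall_sub_mem_ideal
    (I := fun p : s => Ideal.span {((p : ℕ) : ℤ) ^ e p}) (by
      intro p q hpq
      rw [Function.onFun, Ideal.isCoprime_span_singleton_iff]
      exact (Nat.isCoprime_iff_coprime.2 ((Nat.coprime_primes (hs p p.2) (hs q q.2)).2
        (Subtype.coe_ne_coe.2 hpq))).pow) fun p => f p
  exact ⟨x, fun p hp => Ideal.mem_span_singleton.1 (hx ⟨p, hp⟩)⟩

theorem natCast_dvd_int_of_primePow {M : ℕ} (hM : M ≠ 0) {x : ℤ}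
    (h : ∀ p ∈ M.primeFactors, (p : ℤ) ^ M.factorization p ∣ x) : (M : ℤ) ∣ x := by
  rw [← Int.natAbs_dvd_natAbs, Int.natAbs_natCast, Nat.dvd_iff_prime_pow_dvd_dvd]
  intro p k hp hk
  rcases Nat.eq_zero_or_pos k with rfl | hk0
  · simp
  have hpM : p ∈ M.primeFactors :=
    Nat.mem_primeFactors.2 ⟨hp, (dvd_pow_self p hk0.ne').trans hk, hM⟩
  refine (pow_dvd_pow p ((hp.pow_dvd_iff_le_factorization hM).1 hk)).trans ?_
  have := Int.natAbs_dvd_natAbs.2 (h p hpM)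
  simpa [Int.natAbs_pow] using this

theorem dvd_vecDet_iff {m : ℤ} {c x y : ℤ × ℤ} (h1 : m ∣ x.1 - y.1) (h2 : m ∣ x.2 - y.2) :
    m ∣ vecDet c x ↔ m ∣ vecDet c y := by
  have : vecDet c x = c.1 * (x.2 - y.2) - c.2 * (x.1 - y.1) + vecDet c y := by
    simp only [vecDet]; ring
  rw [this, dvd_add_right (dvd_sub (h2.mul_left _) (h1.mul_left _))]

/-- If the lattices `n i ∣ vecDet (c i) x` have distinct slots outside those of `M`, then every
primitive vector is congruent modulo `M` to one that avoids all of them. -/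
theorem exists_avoiding {ι : Type*} [Fintype ι] {M N : ℕ} (hMN : M ∣ N) (hN : N ≠ 0)
    (c : ι → ℤ × ℤ) (hc : ∀ i, IsCoprime (c i).1 (c i).2) (n : ι → ℕ) (hn : ∀ i, n i ∣ N)
    (f : ι → Σ _ : ℕ, ℕ) (hf : Function.Injective f) (hfm : ∀ i, f i ∈ slots (n i) \ slots M)
    (v : ℤ × ℤ) (hv : IsCoprime v.1 v.2) :
    ∃ x : ℤ × ℤ, (M : ℤ) ∣ x.1 - v.1 ∧ (M : ℤ) ∣ x.2 - v.2 ∧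
      ∀ i, ¬ (n i : ℤ) ∣ vecDet (c i) x := by
  classical
  have hM : M ≠ 0 := ne_zero_of_dvd_ne_zero hN hMN
  -- The lattices matched to slots of level `j` at `p`; injectivity of `f` bounds their number.
  let s (p j : ℕ) : Finset ι := Finset.univ.filter fun i =>
    (f i).1 = p ∧ (f i).2 ∈ Finset.Ico (primeSlots p (j - 1)) (primeSlots p j)
  have hs (p j : ℕ) : (s p (j + 1)).card ≤ primeSlots p (j + 1) - primeSlots p j := by
    rw [← Nat.card_Ico]
    refine Finset.card_le_card_of_injOn (fun i => (f i).2) ?_ ?_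
    · intro i hi
      exact (Finset.mem_filter.1 hi).2.2
    · intro i hi i' hi' h
      have h1 := (Finset.mem_filter.1 hi).2.1
      have h2 := (Finset.mem_filter.1 hi').2.1
      exact hf (Sigma.ext (h1.trans h2.symm) (heq_of_eq h))
  have hloc (p : ℕ) (hp : p ∈ N.primeFactors) : ∃ y : ℤ × ℤ,
      (p : ℤ) ^ M.factorization p ∣ y.1 - v.1 ∧ (p : ℤ) ^ M.factorization p ∣ y.2 - v.2 ∧
      ∀ j, M.factorization p < j → j ≤ N.factorization p → ∀ i ∈ s p j,
        ¬ (p : ℤ) ^ j ∣ vecDet (c i) y := by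
    have hpp := Nat.prime_of_mem_primeFactors hp
    obtain ⟨u, -, hu⟩ := exists_digits hpp c hc (s p) (hs p) v
      (fun h => (Nat.prime_iff_prime_int.1 hpp).not_isUnit (hv.isUnit_of_dvd' h.1 h.2))
      (M.factorization p) (N.factorization p)
    refine ⟨_, ?_, ?_, fun j h1 h2 => hu j h1 (h2.trans (Nat.le_add_left _ _))⟩ <;> simp
  choose! y hy1 hy2 hy using hloc
  obtain ⟨a, ha⟩ := exists_forall_dvd_sub N.primeFactors (fun p => Nat.prime_of_mem_primeFactors)
    N.factorization fun p => (y p).1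
  obtain ⟨b, hb⟩ := exists_forall_dvd_sub N.primeFactors (fun p => Nat.prime_of_mem_primeFactors)
    N.factorization fun p => (y p).2
  have hle (p : ℕ) : M.factorization p ≤ N.factorization p :=
    (Nat.factorization_le_iff_dvd hM hN).2 hMN p
  have hsub := Nat.primeFactors_mono hMN hN
  refine ⟨(a, b), natCast_dvd_int_of_primePow hM fun p hp => ?_,
    natCast_dvd_int_of_primePow hM fun p hp => ?_, fun i hi => ?_⟩
  · have := dvd_add ((pow_dvd_pow _ (hle p)).trans (ha p (hsub hp))) (hy1 p (hsub hp))
    simpa using this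
  · have := dvd_add ((pow_dvd_pow _ (hle p)).trans (hb p (hsub hp))) (hy2 p (hsub hp))
    simpa using this
  · have hni : n i ≠ 0 := ne_zero_of_dvd_ne_zero hN (hn i)
    obtain ⟨hin, hout⟩ := Finset.mem_sdiff.1 (hfm i)
    have hp := Finset.mem_sigma.1 hin |>.1
    generalize hfi : f i = q at *
    obtain ⟨p, k⟩ := q
    rw [mem_slots] at hin hout
    obtain ⟨j, hj1, hje, hjk, hkj⟩ := exists_level hin
    have hpp := Nat.prime_of_mem_primeFactors hp
    -- A slot outside `slots M` lies at a level not fixed by the residue of `v` modulo `M`, so its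
    -- digit was free.
    have hMj : M.factorization p < j := by
      by_contra! h
      exact hout (hkj.trans_le (primeSlots_mono p h))
    have hjN : j ≤ N.factorization p :=
      hje.trans ((Nat.factorization_le_iff_dvd hni hN).2 (hn i) p)
    have hpN : p ∈ N.primeFactors := Nat.primeFactors_mono (hn i) hN hp
    have hpj : (p : ℤ) ^ j ∣ n i := by
      exact_mod_cast (hpp.pow_dvd_iff_le_factorization hni).2 hje
    refine hy p hpN j hMj hjN i ?_ ((dvd_vecDet_iff ?_ ?_).1 (hpj.trans hi))
    · simp [s, hfi, hjk, hkj]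
    · exact (pow_dvd_pow _ hjN).trans (ha p hpN)
    · exact (pow_dvd_pow _ hjN).trans (hb p hpN)

/-! ### The covering bound -/

theorem IsIrredundantCovering.indexLcm_ne_zero {C : Finset (AddSubgroup (ℤ × ℤ))}
    (hC : IsIrredundantCovering C) : indexLcm C ≠ 0 := by
  rw [indexLcm, Ne, Finset.lcm_eq_zero_iff]
  rintro ⟨L, hL, h0⟩
  exact (hC.isCovering.finiteIndex L hL).index_ne_zero h0

/-- A proper divisor `M` of the index lcm cannot minimise the number of lattices of index not
dividing `M` plus `simpsonG M` among all divisors of the index lcm. -/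
theorem IsIrredundantCovering.not_minimal {C : Finset (AddSubgroup (ℤ × ℤ))}
    (hC : IsIrredundantCovering C) {M : ℕ} (hM : M ∣ indexLcm C) (hne : M ≠ indexLcm C) :
    ∃ M', M' ∣ indexLcm C ∧
      (C.filter fun L => ¬ L.index ∣ M').card + simpsonG M' <
        (C.filter fun L => ¬ L.index ∣ M).card + simpsonG M := by
  classical
  by_contra! hmin
  have hN := hC.indexLcm_ne_zero
  have hM0 : M ≠ 0 := ne_zero_of_dvd_ne_zero hN hM
  have hdvd (L) (hL : L ∈ C) : L.index ∣ indexLcm C := Finset.dvd_lcm hL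
  have hidx0 (L) (hL : L ∈ C) : L.index ≠ 0 := ne_zero_of_dvd_ne_zero hN (hdvd L hL)
  have hss : (C.filter fun L => L.index ∣ M) ⊂ C := by
    refine (Finset.filter_subset _ _).ssubset_of_ne fun h => hne ?_
    exact Nat.dvd_antisymm hM (Finset.lcm_dvd fun L hL => (Finset.filter_eq_self.1 h) L hL)
  obtain ⟨v, hv, hvC⟩ := hC.exists_isCoprime_notMem hss
  choose! c hcL hc using fun L (hL : L ∈ C) => hC.exists_isCoprime_mem hL
  let R := C.filter fun L => ¬ L.index ∣ M
  have hRC (i : R) : i.1 ∈ C := (Finset.mem_filter.1 i.2).1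
  obtain ⟨f, hf, hfm⟩ := (Finset.all_card_le_biUnion_card_iff_exists_injective
    fun i : R => slots i.1.index \ slots M).1 (by
    intro U
    -- Passing from `M` to this divisor drops the lattices of `U` from the count, so by minimality
    -- at least `U.card` slots are gained: Hall's inequality for `U`.
    let M' := M.lcm (U.lcm fun i => i.1.index)
    have hUN : (U.lcm fun i => i.1.index) ∣ indexLcm C :=
      Finset.lcm_dvd fun i _ => hdvd _ (hRC i)
    have hM'N : M' ∣ indexLcm C := Nat.lcm_dvd hM hUN
    have hslots : slots M' = slots M ∪ U.biUnion fun i => slots i.1.index := by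
      rw [slots_lcm hM0 (ne_zero_of_dvd_ne_zero hN hUN),
        slots_finset_lcm U _ fun i _ => hidx0 _ (hRC i)]
    have hbi : (U.biUnion fun i => slots i.1.index \ slots M) = slots M' \ slots M := by
      rw [hslots]
      ext q
      simp only [Finset.mem_biUnion, Finset.mem_sdiff, Finset.mem_union]
      tauto
    have hcardG : (slots M' \ slots M).card + simpsonG M = simpsonG M' := by
      rw [← card_slots, ← card_slots, Finset.card_sdiff_add_card_eq_card]
      exact slots_subset (ne_zero_of_dvd_ne_zero hN hM'N) (Nat.dvd_lcm_left _ _)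
    have hU : U.card + (C.filter fun L => ¬ L.index ∣ M').card ≤ R.card := by
      rw [← Finset.card_image_of_injective U Subtype.val_injective,
        ← Finset.card_union_of_disjoint]
      · refine Finset.card_le_card (Finset.union_subset ?_ ?_)
        · intro L hL
          obtain ⟨i, -, rfl⟩ := Finset.mem_image.1 hL
          exact i.2
        · intro L hL
          obtain ⟨h1, h2⟩ := Finset.mem_filter.1 hL
          exact Finset.mem_filter.2 ⟨h1, fun h => h2 (h.trans (Nat.dvd_lcm_left _ _))⟩
      · rw [Finset.disjoint_left]
        intro L hL hL'
        obtain ⟨i, hi, rfl⟩ := Finset.mem_image.1 hL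
        exact (Finset.mem_filter.1 hL').2
          ((Finset.dvd_lcm (f := fun i : R => i.1.index) hi).trans (Nat.dvd_lcm_right _ _))
    have := hmin M' hM'N
    rw [hbi]
    change R.card + _ ≤ _ at this
    omega)
  obtain ⟨x, hx1, hx2, hx⟩ := exists_avoiding hM hN (fun i : R => c i.1) (fun i => hc _ (hRC i))
    (fun i => i.1.index) (fun i => hdvd _ (hRC i)) f hf hfm v hv
  have hxC : x ∈ ⋃ L ∈ C, (L : Set (ℤ × ℤ)) := hC.isCovering.covers ▸ Set.mem_univ x
  simp only [Set.mem_iUnion, SetLike.mem_coe, exists_prop] at hxC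
  obtain ⟨L, hL, hxL⟩ := hxC
  rw [mem_iff_index_dvd_vecDet (hc L hL) (hcL L hL)] at hxL
  by_cases hLM : L.index ∣ M
  · refine hvC L (Finset.mem_filter.2 ⟨hL, hLM⟩) ?_
    rw [mem_iff_index_dvd_vecDet (hc L hL) (hcL L hL)]
    have hLM' : (L.index : ℤ) ∣ M := by exact_mod_cast hLM
    exact (dvd_vecDet_iff (hLM'.trans hx1) (hLM'.trans hx2)).1 hxL
  · exact hx ⟨L, Finset.mem_filter.2 ⟨hL, hLM⟩⟩ hxL

theorem IsIrredundantCovering.simpsonG_lt {C : Finset (AddSubgroup (ℤ × ℤ))}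
    (hC : IsIrredundantCovering C) {D : ℕ} (hD : D ∣ indexLcm C) (hne : D ≠ indexLcm C) :
    simpsonG (indexLcm C) < (C.filter fun L => ¬ L.index ∣ D).card + simpsonG D := by
  have hN := hC.indexLcm_ne_zero
  let φ (M : ℕ) := (C.filter fun L => ¬ L.index ∣ M).card + simpsonG M
  obtain ⟨M, hM, hmin⟩ := Finset.exists_min_image (indexLcm C).properDivisors φ
    ⟨D, Nat.mem_properDivisors.2 ⟨hD, (Nat.le_of_dvd hN.bot_lt hD).lt_of_ne hne⟩⟩
  obtain ⟨hMN, hlt⟩ := Nat.mem_properDivisors.1 hM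
  have hφN : φ (indexLcm C) = simpsonG (indexLcm C) := by
    have : (C.filter fun L => ¬ L.index ∣ indexLcm C) = ∅ :=
      Finset.filter_eq_empty_iff.2 fun L hL => not_not.2 (Finset.dvd_lcm hL)
    simp [φ, this]
  -- `M` is minimal among proper divisors only, so the strictly better divisor must be the lcm
  -- itself.
  obtain ⟨M', hM', hless⟩ := hC.not_minimal hMN hlt.ne
  have hM'N : M' = indexLcm C := by
    by_contra h
    exact absurd hless (not_lt.2 (hmin M' (Nat.mem_properDivisors.2
      ⟨hM', (Nat.le_of_dvd hN.bot_lt hM').lt_of_ne h⟩)))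
  rw [← hφN]
  exact (hM'N ▸ hless : φ (indexLcm C) < φ M).trans_le (hmin D (Nat.mem_properDivisors.2
    ⟨hD, (Nat.le_of_dvd hN.bot_lt hD).lt_of_ne hne⟩))

theorem IsIrredundantCovering.eq_singleton_top {C : Finset (AddSubgroup (ℤ × ℤ))}
    (hC : IsIrredundantCovering C) (h : indexLcm C = 1) : C = {⊤} := by
  refine Finset.eq_singleton_iff_nonempty_unique_mem.2 ⟨?_, fun L hL => ?_⟩
  · rw [Finset.nonempty_iff_ne_empty]
    rintro rfl
    exact Set.empty_ne_univ (by simpa using hC.isCovering.covers)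
  · exact AddSubgroup.index_eq_one.1 (Nat.dvd_one.1 (h ▸ Finset.dvd_lcm hL))

theorem IsIrredundantCovering.one_add_simpsonG_le_card {C : Finset (AddSubgroup (ℤ × ℤ))}
    (hC : IsIrredundantCovering C) : 1 + simpsonG (indexLcm C) ≤ C.card := by
  -- For the trivial covering `1` is not a proper divisor of the lcm, and the bound is an equality.
  by_cases h : indexLcm C = 1
  · rw [h, hC.eq_singleton_top h]
    simp [simpsonG]
  · have h1 := hC.simpsonG_lt (one_dvd _) (Ne.symm h)
    have h2 : (C.filter fun L => ¬ L.index ∣ 1).card ≤ C.card := Finset.card_filter_le _ _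
    have h3 : simpsonG 1 = 0 := by simp [simpsonG]
    omega

theorem theoremB (C : Finset (AddSubgroup (ℤ × ℤ))) (hC : IsIrredundantCovering C) :
    (∀ D : ℕ, D ∣ indexLcm C → D ≠ indexLcm C →
      (1 : ℤ) + (simpsonG (indexLcm C) : ℤ) - (simpsonG D : ℤ) ≤
        ((C.filter fun L => ¬ L.index ∣ D).card : ℤ)) ∧
    (C ≠ {⊤} → 1 < indexLcm C ∧ 1 + simpsonG (indexLcm C) ≤ C.card) ∧
    (indexLcm C).primeFactors.card + 1 +
        ∑ p ∈ (indexLcm C).primeFactors, (indexLcm C).factorization p * (p - 1) ≤ C.card := by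
  have hcard := hC.one_add_simpsonG_le_card
  refine ⟨fun D hD hne => ?_, fun hne => ⟨?_, hcard⟩, ?_⟩
  · have := hC.simpsonG_lt hD hne
    omega
  · have h0 := hC.indexLcm_ne_zero
    have h1 : indexLcm C ≠ 1 := fun h => hne (hC.eq_singleton_top h)
    omega
  · rw [simpsonG, Finset.sum_add_distrib, Finset.sum_const, smul_eq_mul, mul_one] at hcard
    omega
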